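/- Let $n$ be a natural number, let $\gamma_n$ be the Gaussian probability measure $d\gamma_n(x)=(2\pi)^{-n/2}e^{-|x|^2/2}\,dx$ on $\mathbb{R}^n$, and for $\varphi:\mathbb{R}^n\to\mathbb{R}\cup\{+\infty\}$ let $\varphi^*(y)=\sup_{x\in\mathbb{R}^n}\{\langle x,y\rangle-\varphi(x)\}$ denote its Legendre transform. Let $\mathcal{L}_o'$ be the class of non-negative convex functions $\varphi$ on $\mathbb{R}^n$ that are finite and of class $C^2$ with positive definite Hessian at each point, satisfy $\lim_{|x|\to+\infty}\varphi(x)=+\infty$ and $\lim_{|x|\to+\infty}\varphi(x)/|x|=+\infty$, and for which there are constants $a,b>0$ with $\varphi(x)\le b|x|^{1+a}$ for all $x$ with $|x|$ large enough. For $p<0$ and $\varphi\in\mathcal{L}_o'$, the functional $p$-th dual curvature measure $\widetilde{C}_p(\varphi,\cdot)$ is the push-forward of the measure $\varphi^{-p}\,d\gamma_n$ under the gradient map $\nabla\varphi$, that is, $$\int_{\mathbb{R}^n}g(z)\,d\widetilde{C}_p(\varphi,z)=\int_{\mathbb{R}^n}g(\nabla\varphi(x))\,\varphi(x)^{-p}\,d\gamma_n(x)$$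 for every bounded continuous $g:\mathbb{R}^n\to\mathbb{R}$. A convex function $\varphi$ is called an admissible perturbation for a convex function $\psi$ if there is a constant $c>0$ such that $\varphi^*-c\,\psi^*$ is convex. **Theorem.** Let $q\le 0$ and let $\varphi_1,\varphi_2\in\mathcal{L}_o'$ with $\varphi_1(0)=\varphi_2(0)=0$. Assume that $\varphi_1$ is an admissible perturbation for $\varphi_2$ and that $\varphi_2$ is an admissible perturbation for $\varphi_1$. If $\widetilde{C}_{q-1}(\varphi_1,\cdot)=\widetilde{C}_{q-1}(\varphi_2,\cdot)$, then - if $q=0$, there is $x_0\in\mathbb{R}^n$ such that $\varphi_1(x)=\varphi_2(x-x_0)$ for all $x\in\mathbb{R}^n$; - if $q<0$, then $\varphi_1(x)=\varphi_2(x)$ for all $x\in\mathbb{R}^n$. -/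

import Mathlib

open Filter Topology MeasureTheory

noncomputable section

namespace FunctionalDual

/-- A convex function `ℝⁿ → ℝ ∪ {+∞}`, encoded as a function with values in the extended reals
that never takes the value `-∞` (with the usual convention `0 * ∞ = 0`). -/
def IsConvex {n : ℕ} (φ : EuclideanSpace ℝ (Fin n) → EReal) : Prop :=
  (∀ x, φ x ≠ ⊥) ∧
    ∀ x y : EuclideanSpace ℝ (Fin n), ∀ l : ℝ, 0 ≤ l → l ≤ 1 →
      φ ((1 - l) • x + l • y) ≤ ((1 - l : ℝ) : EReal) * φ x + (l : EReal) * φ y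

/-- The class `ℒ` of proper convex functions `φ : ℝⁿ → ℝ ∪ {+∞}` with `φ(x) → +∞`
as `|x| → +∞`. -/
structure IsL {n : ℕ} (φ : EuclideanSpace ℝ (Fin n) → EReal) : Prop where
  convex : IsConvex φ
  proper : ∃ x, φ x ≠ ⊤
  coercive : Tendsto φ (Bornology.cobounded (EuclideanSpace ℝ (Fin n))) (𝓝 ⊤)

/-- The class `𝒞²₊`: finite, twice continuously differentiable functions on `ℝⁿ` whose Hessian is
positive definite at each point. -/
def IsC2Plus {n : ℕ} (φ : EuclideanSpace ℝ (Fin n) → EReal) : Prop :=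
  (∀ x, φ x ≠ ⊥ ∧ φ x ≠ ⊤) ∧
    ContDiff ℝ 2 (fun x => (φ x).toReal) ∧
      ∀ x v : EuclideanSpace ℝ (Fin n), v ≠ 0 →
        0 < fderiv ℝ (fderiv ℝ (fun z => (φ z).toReal)) x v v

/-- The class `ℒ'` of functions in `ℒ` that are of class `𝒞²₊` and grow superlinearly. -/
structure IsL' {n : ℕ} (φ : EuclideanSpace ℝ (Fin n) → EReal) : Prop extends IsL φ where
  c2plus : IsC2Plus φ
  superlinear : Tendsto (fun x => φ x / ((‖x‖ : ℝ) : EReal))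
    (Bornology.cobounded (EuclideanSpace ℝ (Fin n))) (𝓝 ⊤)

/-- The class `ℒ'ₒ` of non-negative functions in `ℒ'` of at most polynomial growth:
`φ(x) ≤ b |x| ^ (1 + a)` for all `x` of large norm, for some constants `a, b > 0`. -/
structure IsLo' {n : ℕ} (φ : EuclideanSpace ℝ (Fin n) → EReal) : Prop extends IsL' φ where
  nonneg : ∀ x, 0 ≤ φ x
  growth : ∃ a b : ℝ, 0 < a ∧ 0 < b ∧
    ∀ᶠ x in Bornology.cobounded (EuclideanSpace ℝ (Fin n)),
      φ x ≤ ((b * ‖x‖ ^ (1 + a) : ℝ) : EReal)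

/-- The Legendre transform `φ*(y) = sup_x (⟨x, y⟩ - φ(x))`. -/
def legendre {n : ℕ} (φ : EuclideanSpace ℝ (Fin n) → EReal) :
    EuclideanSpace ℝ (Fin n) → EReal :=
  fun y => ⨆ x, ((inner ℝ x y : ℝ) : EReal) - φ x

/-- `φ` is an admissible perturbation for `ψ`: `φ* - c ψ*` is convex for some `c > 0`. -/
def AdmissiblePerturbation {n : ℕ} (φ ψ : EuclideanSpace ℝ (Fin n) → EReal) : Prop :=
  ∃ c : ℝ, 0 < c ∧ IsConvex (fun y => legendre φ y - (c : EReal) * legendre ψ y)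

/-- The Gaussian probability measure `dγₙ = (2π)^(-n/2) exp(-|x|²/2) dx` on `ℝⁿ`. -/
def gaussian (n : ℕ) : Measure (EuclideanSpace ℝ (Fin n)) :=
  volume.withDensity fun x =>
    ENNReal.ofReal ((2 * Real.pi) ^ (-(n : ℝ) / 2) * Real.exp (-‖x‖ ^ 2 / 2))

/-- The functional `q`-th dual curvature measure of a non-negative convex function `φ`: the
push-forward under `∇φ` of the measure `φ^(-q) dγₙ`. -/
def dualCurvatureMeasure {n : ℕ} (q : ℝ) (φ : EuclideanSpace ℝ (Fin n) → EReal) :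
    Measure (EuclideanSpace ℝ (Fin n)) :=
  ((gaussian n).withDensity fun x => (φ x).toENNReal ^ (-q)).map
    (gradient fun x => (φ x).toReal)

end FunctionalDual

end

/-!
Write `γ` for the Gaussian measure, `r = 1 - q > 0`, `ψᵢ = φᵢ*`, and `ν` for the common
push-forward of `φᵢ ^ r dγ` under `∇φᵢ`. Young's inequality `⟨x, y⟩ ≤ φⱼ(x) + ψⱼ(y)` holds with
equality when `j = i` and `y = ∇φᵢ(x)`, so that
`φᵢ(x) + ψᵢ(∇φᵢ(x)) ≤ φⱼ(x) + ψⱼ(∇φᵢ(x))` (`conjugate_gradient_add_le`).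
Integrating this against `φᵢ ^ r dγ` gives
`∫ φᵢ ^ (r + 1) dγ + ∫ ψᵢ dν ≤ ∫ φⱼ φᵢ ^ r dγ + ∫ ψⱼ dν`
(`lintegral_add_lintegral_conjugate_le`). Both integrals `∫ ψᵢ dν` are finite, because
`ψᵢ(∇φᵢ(x)) = ⟨x, ∇φᵢ(x)⟩ - φᵢ(x) ≤ φᵢ(2x)` grows at most polynomially. Adding the inequalities
for `(i, j) = (1, 2)` and `(2, 1)` therefore cancels them, and leaves
`∫ (φ₁ - φ₂) (φ₁ ^ r - φ₂ ^ r) dγ ≤ 0`.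
The integrand is non-negative and vanishes only where `φ₁ = φ₂`, hence `φ₁ = φ₂` almost
everywhere, and everywhere by continuity.

For `q = 0` the conclusion allows a translation by `x₀`. Since `φ₁` and `φ₂` are both normalised to
vanish at their minimum `0`, the translation is trivial, and `x₀ = 0` is the witness.
-/

open Filter MeasureTheory
open scoped ENNReal

noncomputable section

namespace FunctionalDual

/-! ### Gradients and conjugates of convex functions -/

section Conjugate

variable {E : Type*} [NormedAddCommGroup E] [InnerProductSpace ℝ E]

theorem add_inner_gradient_le [CompleteSpace E] {f : E → ℝ} (hf : ConvexOn ℝ Set.univ f) {x : E}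
    (hd : DifferentiableAt ℝ f x) (y : E) :
    f x + inner ℝ (gradient f x) (y - x) ≤ f y := by
  have hline : HasDerivAt (fun t : ℝ => f (AffineMap.lineMap x y t))
      (inner ℝ (gradient f x) (y - x)) 0 := by
    have h1 : HasFDerivAt f (fderiv ℝ f x) (AffineMap.lineMap x y (0 : ℝ)) := by
      simpa using hd.hasFDerivAt
    have h2 : HasDerivAt (AffineMap.lineMap x y : ℝ → E) (y - x) 0 :=
      AffineMap.hasDerivAt_lineMap
    have h3 := h1.comp_hasDerivAt (0 : ℝ) h2
    rwa [← toDual_gradient, InnerProductSpace.toDual_apply_apply] at h3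
  have hconv : ConvexOn ℝ Set.univ (fun t : ℝ => f (AffineMap.lineMap x y t)) :=
    hf.comp_affineMap (AffineMap.lineMap x y : ℝ →ᵃ[ℝ] E)
  have h := hconv.le_slope_of_hasDerivAt (Set.mem_univ 0) (Set.mem_univ 1) zero_lt_one hline
  simp only [slope_def_field, AffineMap.lineMap_apply_zero, AffineMap.lineMap_apply_one, sub_zero,
    div_one] at h
  linarith

/-- The Legendre transform `y ↦ sup_x (⟨x, y⟩ - f x)` of a real function `f` with `f 0 ≤ 0`, as an
extended non-negative number. Truncating each term at `0` does not change the supremum, since the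
term at `x = 0` is already non-negative. -/
def conjugate (f : E → ℝ) (y : E) : ℝ≥0∞ :=
  ⨆ x, ENNReal.ofReal (inner ℝ x y - f x)

theorem measurable_conjugate [MeasurableSpace E] [OpensMeasurableSpace E] (f : E → ℝ) :
    Measurable (conjugate f) :=
  (lowerSemicontinuous_iSup fun _ =>
    (ENNReal.continuous_ofReal.comp (by fun_prop)).lowerSemicontinuous).measurable

/-- Young's inequality. -/
theorem ofReal_inner_le_add_conjugate (f : E → ℝ) (x y : E) :
    ENNReal.ofReal (inner ℝ x y) ≤ ENNReal.ofReal (f x) + conjugate f y :=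
  calc ENNReal.ofReal (inner ℝ x y)
      = ENNReal.ofReal (f x + (inner ℝ x y - f x)) := by ring_nf
    _ ≤ ENNReal.ofReal (f x) + ENNReal.ofReal (inner ℝ x y - f x) := ENNReal.ofReal_add_le
    _ ≤ ENNReal.ofReal (f x) + conjugate f y := by
      gcongr
      exact le_iSup (fun z => ENNReal.ofReal (inner ℝ z y - f z)) x

variable [CompleteSpace E]

theorem conjugate_gradient_le {f : E → ℝ} (hf : ConvexOn ℝ Set.univ f) {x : E}
    (hd : DifferentiableAt ℝ f x) :
    conjugate f (gradient f x) ≤ ENNReal.ofReal (inner ℝ x (gradient f x) - f x) := by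
  refine iSup_le fun z => ENNReal.ofReal_le_ofReal ?_
  have h := add_inner_gradient_le hf hd z
  rw [inner_sub_right, real_inner_comm z, real_inner_comm x] at h
  linarith

theorem conjugate_gradient_add_le {f g : E → ℝ} (hf : ConvexOn ℝ Set.univ f) (hf0 : f 0 = 0)
    (hfn : ∀ x, 0 ≤ f x) {x : E} (hd : DifferentiableAt ℝ f x) :
    ENNReal.ofReal (f x) + conjugate f (gradient f x) ≤
      ENNReal.ofReal (g x) + conjugate g (gradient f x) := by
  have h := add_inner_gradient_le hf hd 0
  rw [zero_sub, inner_neg_right, real_inner_comm, hf0] at h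
  calc ENNReal.ofReal (f x) + conjugate f (gradient f x)
      ≤ ENNReal.ofReal (f x) + ENNReal.ofReal (inner ℝ x (gradient f x) - f x) := by
        gcongr
        exact conjugate_gradient_le hf hd
    _ = ENNReal.ofReal (inner ℝ x (gradient f x)) := by
        rw [← ENNReal.ofReal_add (hfn x) (by linarith)]
        ring_nf
    _ ≤ _ := ofReal_inner_le_add_conjugate g x _

theorem conjugate_gradient_le_two_smul {f : E → ℝ} (hf : ConvexOn ℝ Set.univ f)
    (hfn : ∀ x, 0 ≤ f x) {x : E} (hd : DifferentiableAt ℝ f x) :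
    conjugate f (gradient f x) ≤ ENNReal.ofReal (f ((2 : ℝ) • x)) := by
  refine (conjugate_gradient_le hf hd).trans (ENNReal.ofReal_le_ofReal ?_)
  have h := add_inner_gradient_le hf hd ((2 : ℝ) • x)
  rw [two_smul, add_sub_cancel_right, real_inner_comm, ← two_smul ℝ x] at h
  linarith [hfn x]

/-- The integrated form of `conjugate_gradient_add_le`. -/
theorem lintegral_add_lintegral_conjugate_le [MeasurableSpace E] [BorelSpace E]
    {f g : E → ℝ} (hf : ConvexOn ℝ Set.univ f) (hf0 : f 0 = 0) (hfn : ∀ x, 0 ≤ f x)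
    (hd : ContDiff ℝ 1 f) (hg : Measurable g) (hgrad : Measurable (gradient f))
    (μ : Measure E) :
    ∫⁻ x, ENNReal.ofReal (f x) ∂μ + ∫⁻ y, conjugate f y ∂(μ.map (gradient f)) ≤
      ∫⁻ x, ENNReal.ofReal (g x) ∂μ + ∫⁻ y, conjugate g y ∂(μ.map (gradient f)) := by
  rw [lintegral_map (measurable_conjugate f) hgrad, lintegral_map (measurable_conjugate g) hgrad,
    ← lintegral_add_left hd.continuous.measurable.ennreal_ofReal,
    ← lintegral_add_left hg.ennreal_ofReal]
  exact lintegral_mono fun x =>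
    conjugate_gradient_add_le hf hf0 hfn (hd.differentiable one_ne_zero x)

end Conjugate

/-! ### Polynomial growth and Gaussian integrals -/

/-- `h` grows at most like a power of the norm at infinity. -/
def PolyGrowth {E : Type*} [NormedAddCommGroup E] (h : E → ℝ) : Prop :=
  ∃ k : ℝ, h =O[Bornology.cobounded E] fun x => ‖x‖ ^ k

namespace PolyGrowth

variable {E : Type*} [NormedAddCommGroup E] {f g : E → ℝ}

theorem mul (hf : PolyGrowth f) (hg : PolyGrowth g) : PolyGrowth fun x => f x * g x := by
  obtain ⟨k, hk⟩ := hf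
  obtain ⟨l, hl⟩ := hg
  refine ⟨k + l, (hk.mul hl).trans_eventuallyEq ?_⟩
  filter_upwards [tendsto_norm_cobounded_atTop.eventually_gt_atTop 0] with x hx
  rw [Real.rpow_add hx]

theorem rpow (hf : PolyGrowth f) {r : ℝ} (hr : 0 ≤ r) : PolyGrowth fun x => f x ^ r := by
  obtain ⟨k, hk⟩ := hf
  refine ⟨k * r, (hk.rpow hr (.of_forall fun x => by positivity)).trans_eventuallyEq ?_⟩
  filter_upwards with x
  rw [Real.rpow_mul (norm_nonneg x)]

theorem comp_two_smul [NormedSpace ℝ E] (hf : PolyGrowth f) :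
    PolyGrowth fun x => f ((2 : ℝ) • x) := by
  obtain ⟨k, hk⟩ := hf
  have ht : Tendsto (fun x : E => (2 : ℝ) • x) (Bornology.cobounded E)
      (Bornology.cobounded E) := by
    rw [← tendsto_norm_atTop_iff_cobounded]
    simpa [norm_smul] using tendsto_norm_cobounded_atTop.const_mul_atTop (zero_lt_two' ℝ)
  refine ⟨k, (hk.comp_tendsto ht).trans ?_⟩
  refine (Asymptotics.isBigO_const_mul_self ((2 : ℝ) ^ k) (fun x : E => ‖x‖ ^ k) _).congr_left ?_
  intro x
  simp [norm_smul, Real.mul_rpow]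

end PolyGrowth

theorem integrable_mul_exp_neg_norm_sq {n : ℕ} {h : EuclideanSpace ℝ (Fin n) → ℝ}
    (hc : Continuous h) (hg : PolyGrowth h) :
    Integrable fun x => h x * Real.exp (-‖x‖ ^ 2 / 2) := by
  obtain ⟨k, hk⟩ := hg
  have hint : Integrable fun x : EuclideanSpace ℝ (Fin n) => Real.exp (-(1 / 4) * ‖x‖ ^ 2) := by
    have h := GaussianFourier.integrable_cexp_neg_mul_sq_norm_add
      (V := EuclideanSpace ℝ (Fin n)) (b := 1 / 4) (by norm_num) 0 0
    refine h.norm.congr (.of_forall fun x => ?_)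
    simp [Complex.norm_exp, ← Complex.ofReal_pow]
  refine (hc.mul (by fun_prop)).locallyIntegrable.integrable_of_isBigO_cocompact
    (g := fun x => Real.exp (-(1 / 4) * ‖x‖ ^ 2)) ?_ (hint.integrableAtFilter _)
  rw [← Metric.cobounded_eq_cocompact]
  -- It suffices that `‖x‖ ^ k` is dominated by `exp (‖x‖ ^ 2 / 4)`.
  have hexp : (fun x : EuclideanSpace ℝ (Fin n) => ‖x‖ ^ k) =O[Bornology.cobounded _]
      fun x => Real.exp (1 / 4 * ‖x‖ ^ 2) := by
    refine (((isLittleO_rpow_exp_pos_mul_atTop k (b := 1 / 4) (by norm_num)).isBigO).comp_tendsto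
      tendsto_norm_cobounded_atTop).trans (Asymptotics.IsBigO.of_bound 1 ?_)
    filter_upwards [tendsto_norm_cobounded_atTop.eventually_ge_atTop 1] with x hx
    simp only [Function.comp_apply, Real.norm_eq_abs, Real.abs_exp, one_mul]
    exact Real.exp_le_exp.2 (by nlinarith)
  refine ((hk.trans hexp).mul (Asymptotics.isBigO_refl
    (fun x : EuclideanSpace ℝ (Fin n) => Real.exp (-‖x‖ ^ 2 / 2)) _)).congr_right fun x => ?_
  rw [← Real.exp_add]
  ring_nf

theorem lintegral_gaussian_ne_top {n : ℕ} {h : EuclideanSpace ℝ (Fin n) → ℝ}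
    (hc : Continuous h) (hg : PolyGrowth h) :
    ∫⁻ x, ENNReal.ofReal (h x) ∂(gaussian n) ≠ ⊤ := by
  rw [gaussian, lintegral_withDensity_eq_lintegral_mul _ (by fun_prop)
    hc.measurable.ennreal_ofReal]
  have hi := (integrable_mul_exp_neg_norm_sq hc hg).const_mul ((2 * Real.pi) ^ (-(n : ℝ) / 2))
  refine (lt_of_eq_of_lt (lintegral_congr fun x => ?_) hi.lintegral_lt_top).ne
  rw [Pi.mul_apply, ← ENNReal.ofReal_mul (by positivity)]
  ring_nf

theorem volume_absolutelyContinuous_gaussian (n : ℕ) :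
    (volume : Measure (EuclideanSpace ℝ (Fin n))) ≪ gaussian n := by
  refine withDensity_absolutelyContinuous' (by fun_prop) (.of_forall fun x => ?_)
  rw [ne_eq, ENNReal.ofReal_eq_zero, not_le]
  positivity

/-! ### Uniqueness for real functions -/

/-- The real form of the class `IsLo'` with the normalisation `f 0 = 0`, without superlinearity and
with the conditions on second derivatives weakened to convexity and class `C¹`. -/
structure IsNormalizedConvex {n : ℕ} (f : EuclideanSpace ℝ (Fin n) → ℝ) : Prop where
  convex : ConvexOn ℝ Set.univ f
  map_zero : f 0 = 0
  nonneg : ∀ x, 0 ≤ f x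
  contDiff : ContDiff ℝ 1 f
  growth : PolyGrowth f

/-- The measure `f ^ r dγ`. -/
def gaussianPow {n : ℕ} (f : EuclideanSpace ℝ (Fin n) → ℝ) (r : ℝ) :
    Measure (EuclideanSpace ℝ (Fin n)) :=
  (gaussian n).withDensity fun x => ENNReal.ofReal (f x ^ r)

namespace IsNormalizedConvex

variable {n : ℕ} {f g : EuclideanSpace ℝ (Fin n) → ℝ} {r : ℝ}

theorem measurable_gradient (hf : IsNormalizedConvex f) : Measurable (gradient f) :=
  ((InnerProductSpace.toDual ℝ _).symm.continuous.comp
    (hf.contDiff.continuous_fderiv one_ne_zero)).measurable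

theorem continuous_rpow (hf : IsNormalizedConvex f) (hr : 0 ≤ r) : Continuous fun x => f x ^ r :=
  hf.contDiff.continuous.rpow_const fun _ => .inr hr

theorem lintegral_gaussianPow (hf : IsNormalizedConvex f) (hr : 0 ≤ r) (hg : Measurable g) :
    ∫⁻ x, ENNReal.ofReal (g x) ∂(gaussianPow f r) =
      ∫⁻ x, ENNReal.ofReal (f x ^ r * g x) ∂(gaussian n) := by
  rw [gaussianPow, lintegral_withDensity_eq_lintegral_mul _
    (hf.continuous_rpow hr).measurable.ennreal_ofReal hg.ennreal_ofReal]
  refine lintegral_congr fun x => ?_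
  rw [Pi.mul_apply, ENNReal.ofReal_mul (Real.rpow_nonneg (hf.nonneg x) r)]

theorem lintegral_rpow_mul_ne_top (hf : IsNormalizedConvex f) (hr : 0 ≤ r) (hc : Continuous g)
    (hg : PolyGrowth g) : ∫⁻ x, ENNReal.ofReal (f x ^ r * g x) ∂(gaussian n) ≠ ⊤ :=
  lintegral_gaussian_ne_top ((hf.continuous_rpow hr).mul hc) ((hf.growth.rpow hr).mul hg)

theorem lintegral_conjugate_ne_top (hf : IsNormalizedConvex f) (hr : 0 ≤ r) :
    ∫⁻ y, conjugate f y ∂((gaussianPow f r).map (gradient f)) ≠ ⊤ := by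
  have hc : Continuous fun x => f ((2 : ℝ) • x) := by
    have := hf.contDiff.continuous
    fun_prop
  rw [lintegral_map (measurable_conjugate f) hf.measurable_gradient]
  refine ne_top_of_le_ne_top (hf.lintegral_rpow_mul_ne_top hr hc hf.growth.comp_two_smul) ?_
  rw [← hf.lintegral_gaussianPow hr hc.measurable]
  exact lintegral_mono fun x => conjugate_gradient_le_two_smul hf.convex hf.nonneg
    (hf.contDiff.differentiable one_ne_zero x)

end IsNormalizedConvex

/-- The rearrangement inequality for the increasing function `t ↦ t ^ r`. -/
theorem rpow_mul_add_rpow_mul_le {a b r : ℝ} (ha : 0 ≤ a) (hb : 0 ≤ b) (hr : 0 ≤ r) :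
    a ^ r * b + b ^ r * a ≤ a ^ r * a + b ^ r * b := by
  rcases le_total a b with h | h
  · nlinarith [Real.rpow_le_rpow ha h hr]
  · nlinarith [Real.rpow_le_rpow hb h hr]

theorem eq_of_rpow_mul_add_rpow_mul_eq {a b r : ℝ} (ha : 0 ≤ a) (hb : 0 ≤ b) (hr : 0 < r)
    (h : a ^ r * b + b ^ r * a = a ^ r * a + b ^ r * b) : a = b := by
  have h0 : (a ^ r - b ^ r) * (a - b) = 0 := by linarith
  rcases mul_eq_zero.1 h0 with h1 | h1
  · exact (Real.rpow_left_inj ha hb hr.ne').1 (sub_eq_zero.1 h1)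
  · exact sub_eq_zero.1 h1

theorem IsNormalizedConvex.eq_of_map_gradient_eq {n : ℕ} {f g : EuclideanSpace ℝ (Fin n) → ℝ} {r : ℝ}
    (hf : IsNormalizedConvex f) (hg : IsNormalizedConvex g) (hr : 0 < r)
    (h : (gaussianPow f r).map (gradient f) = (gaussianPow g r).map (gradient g)) : f = g := by
  have hfc := hf.contDiff.continuous
  have hgc := hg.contDiff.continuous
  have hfr := hf.continuous_rpow hr.le
  have hgr := hg.continuous_rpow hr.le
  have hfrn := fun x => Real.rpow_nonneg (hf.nonneg x) r
  have hgrn := fun x => Real.rpow_nonneg (hg.nonneg x) r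
  have h1 := lintegral_add_lintegral_conjugate_le hf.convex hf.map_zero hf.nonneg hf.contDiff
    hgc.measurable hf.measurable_gradient (gaussianPow f r)
  have h2 := lintegral_add_lintegral_conjugate_le hg.convex hg.map_zero hg.nonneg hg.contDiff
    hfc.measurable hg.measurable_gradient (gaussianPow g r)
  have hBf := hf.lintegral_conjugate_ne_top hr.le
  have hBg := hg.lintegral_conjugate_ne_top hr.le
  rw [← h] at h2 hBg
  rw [hf.lintegral_gaussianPow hr.le hfc.measurable,
    hf.lintegral_gaussianPow hr.le hgc.measurable] at h1
  rw [hg.lintegral_gaussianPow hr.le hfc.measurable,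
    hg.lintegral_gaussianPow hr.le hgc.measurable] at h2
  have hadd : ∀ u v : EuclideanSpace ℝ (Fin n) → ℝ, Measurable u → (∀ x, 0 ≤ u x) →
      (∀ x, 0 ≤ v x) → ∫⁻ x, ENNReal.ofReal (u x + v x) ∂(gaussian n) =
        ∫⁻ x, ENNReal.ofReal (u x) ∂(gaussian n) + ∫⁻ x, ENNReal.ofReal (v x) ∂(gaussian n) := by
    intro u v hu hun hvn
    rw [← lintegral_add_left hu.ennreal_ofReal]
    exact lintegral_congr fun x => ENNReal.ofReal_add (hun x) (hvn x)
  -- Sum the two inequalities and cancel the integrals of the conjugates.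
  have hsum : ∫⁻ x, ENNReal.ofReal (f x ^ r * f x + g x ^ r * g x) ∂(gaussian n) ≤
      ∫⁻ x, ENNReal.ofReal (f x ^ r * g x + g x ^ r * f x) ∂(gaussian n) := by
    rw [hadd _ _ (hfr.fun_mul hfc).measurable (fun x => mul_nonneg (hfrn x) (hf.nonneg x))
        fun x => mul_nonneg (hgrn x) (hg.nonneg x),
      hadd _ _ (hfr.fun_mul hgc).measurable (fun x => mul_nonneg (hfrn x) (hg.nonneg x))
        fun x => mul_nonneg (hgrn x) (hf.nonneg x)]
    refine (ENNReal.add_le_add_iff_right (ENNReal.add_ne_top.2 ⟨hBf, hBg⟩)).1 ?_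
    refine le_of_eq_of_le ?_ ((add_le_add h1 h2).trans_eq ?_) <;> ring
  have hfin : ∫⁻ x, ENNReal.ofReal (f x ^ r * g x + g x ^ r * f x) ∂(gaussian n) ≠ ⊤ := by
    rw [hadd _ _ (hfr.fun_mul hgc).measurable (fun x => mul_nonneg (hfrn x) (hg.nonneg x))
        fun x => mul_nonneg (hgrn x) (hf.nonneg x)]
    exact ENNReal.add_ne_top.2 ⟨hf.lintegral_rpow_mul_ne_top hr.le hgc hg.growth,
      hg.lintegral_rpow_mul_ne_top hr.le hfc hf.growth⟩
  have hae := ae_eq_of_ae_le_of_lintegral_le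
    (.of_forall fun x => ENNReal.ofReal_le_ofReal
      (rpow_mul_add_rpow_mul_le (hf.nonneg x) (hg.nonneg x) hr.le)) hfin
    ((hfr.mul hfc).add (hgr.mul hgc)).measurable.ennreal_ofReal.aemeasurable hsum
  refine (Continuous.ae_eq_iff_eq volume hfc hgc).1 ?_
  filter_upwards [(volume_absolutelyContinuous_gaussian n).ae_le hae] with x hx
  have hxf := hf.nonneg x
  have hxg := hg.nonneg x
  exact eq_of_rpow_mul_add_rpow_mul_eq hxf hxg hr
    ((ENNReal.ofReal_eq_ofReal_iff (by positivity) (by positivity)).1 hx)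

/-! ### From extended-real to real functions -/

namespace IsLo'

variable {n : ℕ} {φ : EuclideanSpace ℝ (Fin n) → EReal}

theorem coe_toReal (h : IsLo' φ) (x : EuclideanSpace ℝ (Fin n)) : ((φ x).toReal : EReal) = φ x :=
  EReal.coe_toReal (h.c2plus.1 x).2 (h.c2plus.1 x).1

theorem isNormalizedConvex (h : IsLo' φ) (h0 : φ 0 = 0) : IsNormalizedConvex fun x => (φ x).toReal where
  convex := by
    refine ⟨convex_univ, fun x _ y _ a b ha hb hab => ?_⟩
    have hc := h.convex.2 x y b hb (by linarith)
    rw [← h.coe_toReal x, ← h.coe_toReal y, ← h.coe_toReal, ← hab, add_sub_cancel_right] at hc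
    exact_mod_cast hc
  map_zero := by simp [h0]
  nonneg x := EReal.toReal_nonneg (h.nonneg x)
  contDiff := h.c2plus.2.1.of_le one_le_two
  growth := by
    obtain ⟨a, b, -, -, hab⟩ := h.growth
    refine ⟨1 + a, Asymptotics.IsBigO.of_bound b ?_⟩
    filter_upwards [hab] with x hx
    rw [← h.coe_toReal x, EReal.coe_le_coe_iff] at hx
    rwa [Real.norm_of_nonneg (EReal.toReal_nonneg (h.nonneg x)),
      Real.norm_of_nonneg (Real.rpow_nonneg (norm_nonneg x) _)]

theorem dualCurvatureMeasure_eq (h : IsLo' φ) {q : ℝ} (hq : q ≤ 0) :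
    dualCurvatureMeasure q φ =
      (gaussianPow (fun x => (φ x).toReal) (-q)).map (gradient fun x => (φ x).toReal) := by
  rw [dualCurvatureMeasure, gaussianPow]
  congr 2
  funext x
  rw [EReal.toENNReal_of_ne_top (h.c2plus.1 x).2,
    ENNReal.ofReal_rpow_of_nonneg (EReal.toReal_nonneg (h.nonneg x)) (neg_nonneg.2 hq)]

end IsLo'

end FunctionalDual

end

theorem mainTheorem2 (n : ℕ) (q : ℝ) (hq : q ≤ 0)
    (φ₁ φ₂ : EuclideanSpace ℝ (Fin n) → EReal)
    (h₁ : FunctionalDual.IsLo' φ₁) (h₂ : FunctionalDual.IsLo' φ₂)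
    (h₁0 : φ₁ 0 = 0) (h₂0 : φ₂ 0 = 0)
    (h₁₂ : FunctionalDual.AdmissiblePerturbation φ₁ φ₂)
    (h₂₁ : FunctionalDual.AdmissiblePerturbation φ₂ φ₁)
    (hC : FunctionalDual.dualCurvatureMeasure (q - 1) φ₁ =
      FunctionalDual.dualCurvatureMeasure (q - 1) φ₂) :
    (q = 0 → ∃ x₀ : EuclideanSpace ℝ (Fin n), ∀ x, φ₁ x = φ₂ (x - x₀)) ∧
      (q < 0 → ∀ x, φ₁ x = φ₂ x) := by
  rw [h₁.dualCurvatureMeasure_eq (by linarith), h₂.dualCurvatureMeasure_eq (by linarith)] at hC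
  have hreal := (h₁.isNormalizedConvex h₁0).eq_of_map_gradient_eq (h₂.isNormalizedConvex h₂0)
    (by linarith) hC
  have heq : ∀ x, φ₁ x = φ₂ x := fun x => by
    rw [← h₁.coe_toReal, ← h₂.coe_toReal]
    exact congrArg _ (congrFun hreal x)
  exact ⟨fun _ => ⟨0, fun x => by rw [sub_zero, heq]⟩, fun _ => heq⟩
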